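/- **Setting.** Fix $d,p$ and write $\|\cdot\|$ for Euclidean norms. Nonstochastic design points $X_1,X_2,\dots\in\mathbb R^d$ satisfy $\|X_i\|<\bar C$. At sample size $n$ one observes $Y_i=f(X_i)+\varepsilon_i\in\mathbb R^p$, $i=1,\dots,n$, and tests $H_0: f\le 0$. *Models.* For $\tau>0$ let $[\tau]$ be the largest integer strictly smaller than $\tau$. $\mathcal F(\tau,L)$ is the set of $g:\mathbb R^d\to\mathbb R$ with continuous partial derivatives up to order $[\tau]$ and $|D^{\nu}g(x)-D^{\nu}g(y)|\le L\|x-y\|^{\tau-[\tau]}$ for all $x,y$ and all multi-indices $|\nu|=[\tau]$. $\mathcal F_\varsigma(\tau,L)$ is the set of $g\in\mathcal F(\tau,L)$ such that, for every $x$ and every unit direction $l$, if the derivative of $g$ at $x$ in direction $l$ is zero, then the derivatives at $x$ in direction $l$ of orders $1,\dots,\varsigma$ are zero. Here $\varsigma=0$ if $\tau\le1$, and $1\le\varsigma\le[\tau]$ if $\tau>1$. For fixed positive constants and $\tau\ge 1/4$, $L>0$, the class $\mathcal G=\mathcal G_n$ consists of the models $w=(f^w,\varepsilon^w)$ such that (a)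 all components $f^w_m$ belong to $\mathcal F_\varsigma(\tau,L)$ and, if $\varsigma<[\tau]$, their partial derivatives of order $\varsigma+1$ are bounded by a fixed constant; (b) $\varepsilon_1,\dots,\varepsilon_n$ are independent with mean zero, $E|\varepsilon_{i,m}|^{4+\delta}\le C$ for a fixed $\delta>0$, all entries of $\Sigma_i=E[\varepsilon_i\varepsilon_i^T]$ and all mixed fourth moments satisfy $|\Sigma_{i,m_1m_2}-\Sigma_{j,m_1m_2}|\le C\|X_i-X_j\|$, $|E[\varepsilon_{i,m_1}\varepsilon_{i,m_2}\varepsilon_{i,m_3}\varepsilon_{i,m_4}]-E[\varepsilon_{j,m_1}\varepsilon_{j,m_2}\varepsilon_{j,m_3}\varepsilon_{j,m_4}]|\le C\|X_i-X_j\|$, and $\Sigma_{i,mm}\ge c>0$. *Test statistic.* Let $H_n=\{\bar C a^k: k=0,\dots,N_n\}$, $a\in(0,1)$, $h_{\min}=\bar Ca^{N_n}\to0$ with $|H_n|\le C\log n$ for large $n$. Let $K:\mathbb R^d\to[0,1]$ vanish outside the unit ball, with $K\ge C>0$ on $\{\|x\|\le1/2\}$; put $K_h(x)=K(x/h)/h^d$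 and $w_h(X_i,X_j)=K_h(X_i-X_j)/\sum_{k\le n}K_h(X_i-X_k)$. For $h\in H_n$ the set of test points $I_h\subset\{1,\dots,n\}$ satisfies $\|X_i-X_j\|>2h$ for distinct $i,j\in I_h$, and every $X_i$, $i\le n$, is within $2h$ of some $X_j$ with $j\in I_h$. Let $S=\{(i,m,h):h\in H_n,\ i\in I_h,\ m\le p\}$, $\hat f_{i,m,h}=\sum_j w_h(X_i,X_j)Y_{j,m}$, $\hat V_{i,m,h}^2=\sum_j w_h(X_i,X_j)^2\hat\Sigma_{j,mm}$ and $\hat T=\max_{s\in S}\hat f_s/\hat V_s$, where the $\hat\Sigma_i$ are positive semidefinite measurable functions of the sample. *Test functions.* Let $g_0:\mathbb R\to[0,1]$ be thrice differentiable and nonincreasing, $g_0=1$ on $(-\infty,0]$, $g_0=0$ on $[1,\infty)$. Let $\beta_n\in(0,C]$, $\alpha\in(0,1)$ and $0<\gamma_n<\alpha/2$ with $\gamma_n$ bounded away from $\alpha/2$. Given the data, let $\tilde Y_i\sim N(0,\hat\Sigma_i)$ be independent. For $A\subset S$ and $q\in(0,1)$ let $c_q(A)$ be the (smallest) solution $c$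 of $E[g_0((T_A-c)/\beta_n)\mid Y]=q$, where $T_A=\max_{(i,m,h)\in A}\sum_j w_h(X_i,X_j)\tilde Y_{j,m}/\hat V_{i,m,h}$. Put $g^{PIA}_{1-\alpha}(x)=g_0((x-c_{1-\alpha}(S))/\beta_n)$, $S^{RMS}=\{s\in S:\hat f_s/\hat V_s>-2(c_{1-\gamma_n}(S)+\beta_n)\}$, and $g^{RMS}_{1-\alpha}(x)=g_0((x-c_{1-\alpha+2\gamma_n}(S^{RMS}))/\beta_n)$ (set to $1$ if $S^{RMS}=\emptyset$). On observing $\hat T$, the test accepts $H_0$ with probability $g^{P}_{1-\alpha}(\hat T)$, $P\in\{PIA,RMS\}$. *Further assumptions.* There are $0<C_1<C_2<\infty$ such that, for all large $n$, all $i\in\mathbb N$ and $h\in H_n$, $C_1nh^d\le\#\{j\le n:\|X_j-X_i\|\le h\}\le C_2nh^d$. Moreover $(\log n)^4/(\beta_n^{10}h_{\min}^{3d}n)\to0$. **Theorem.** Let $f^{w(0)}$ satisfy (a) and $\rho(w(0),H_0)=\sup_{i\in\mathbb N,\,m\le p}[f^{w(0)}_m(X_i)]_+>0$. Let $a_n>0$,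 $a_n\to0$, $\sqrt{n/\log n}\,a_n\to\infty$, and $f^n=a_nf^{w(0)}$. Assume that, for some $0<\phi<1/(2+d)$ and $\kappa=1/(2+d)-\phi$, $\max_{i\le n}\|\hat\Sigma_i-\Sigma_i\|=o_p(n^{-\kappa})$ in spectral norm, uniformly over the models $w\in\mathcal G_n$ with $f^w=f^n$. Then for $P=PIA$ and for $P=RMS$ the function $g^P_{1-\alpha}(\hat T)$ of the sample is measurable, and $$\sup_{w\in\mathcal G_n,\ f^w=f^n}E_w\big[g^P_{1-\alpha}(\hat T)\big]\to0\qquad(n\to\infty),$$ i.e. both tests reject with probability tending to one, uniformly over the noise distributions in the class. -/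

import Mathlib

open MeasureTheory ProbabilityTheory Filter Topology
open scoped ENNReal

noncomputable section

namespace CMITest

/-- Euclidean space `ℝ^k` with its Euclidean norm. -/
abbrev E (k : ℕ) : Type := EuclideanSpace ℝ (Fin k)

/-! ### Smoothness classes of regression functions -/

/-- The largest integer strictly smaller than `τ` (for `τ > 0`). -/
def holderOrder (τ : ℝ) : ℕ := ⌈τ⌉₊ - 1

/-- The partial derivative of order `k` of `g` at `x` in the coordinates `idx 0, …, idx (k - 1)`. -/
def partialDeriv {d : ℕ} (k : ℕ) (idx : Fin k → Fin d) (g : E d → ℝ) (x : E d) : ℝ :=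
  iteratedFDeriv ℝ k g x (fun j => EuclideanSpace.single (idx j) (1 : ℝ))

/-- The `k`-th derivative of `g` at `x` in the direction `l`. -/
def dirDeriv {d : ℕ} (k : ℕ) (g : E d → ℝ) (x l : E d) : ℝ :=
  iteratedDeriv k (fun t : ℝ => g (x + t • l)) 0

/-- The Hölder class `F(τ, L)`: with `k` the largest integer strictly smaller than `τ`, the
function has continuous partial derivatives up to order `k`, and those of order `k` are Hölder
with exponent `τ - k` and constant `L`. -/
structure IsHolder {d : ℕ} (τ L : ℝ) (g : E d → ℝ) : Prop where
  contDiff : ContDiff ℝ (holderOrder τ : ℕ) g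
  holder : ∀ (idx : Fin (holderOrder τ) → Fin d) (x y : E d),
    |partialDeriv (holderOrder τ) idx g x - partialDeriv (holderOrder τ) idx g y|
      ≤ L * ‖x - y‖ ^ (τ - (holderOrder τ : ℝ))

/-- The class `F_ς(τ, L)`: wherever the first derivative in a direction vanishes, so do the
derivatives of orders `1, …, ς` in this direction (no condition if `ς = 0`). It is not required
that some derivative of order `ς + 1` be nonzero, so that flatter functions, in particular
constants, belong to the class as well; this only makes the class larger. -/
structure IsFlatHolder {d : ℕ} (ς : ℕ) (τ L : ℝ) (g : E d → ℝ) : Prop where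
  isHolder : IsHolder τ L g
  flat : ∀ x l : E d, ‖l‖ = 1 → dirDeriv 1 g x l = 0 →
    ∀ k : ℕ, 1 ≤ k → k ≤ ς → dirDeriv k g x l = 0

/-! ### The class of models -/

/-- The constants of the class of models: moment exponent `δ`, moment bound, Lipschitz constant of
the second and fourth moments, lower bound on the variances; smoothness `τ`, Hölder constant `L`,
flatness `ς`, and bound on the derivatives of order `ς + 1`. -/
structure Constants where
  δ : ℝ
  momBound : ℝ
  lip : ℝ
  varLow : ℝ
  τ : ℝ
  L : ℝ
  ς : ℕ
  derBound : ℝ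

/-- The admissible values of the constants. -/
structure Constants.Admissible (c : Constants) : Prop where
  δ_pos : 0 < c.δ
  momBound_pos : 0 < c.momBound
  lip_pos : 0 < c.lip
  varLow_pos : 0 < c.varLow
  τ_ge : 1 / 4 ≤ c.τ
  L_pos : 0 < c.L
  ς_of_le_one : c.τ ≤ 1 → c.ς = 0
  ς_of_one_lt : 1 < c.τ → 1 ≤ c.ς ∧ c.ς ≤ holderOrder c.τ
  derBound_pos : 0 < c.derBound

/-- A model at sample size `n`: a vector-valued regression function and the laws of the
independent disturbances `ε_1, …, ε_n`. -/
structure Model (d p n : ℕ) where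
  f : E d → E p
  ν : Fin n → Measure (E p)

/-- The assumption on the regression function. -/
structure RegressionAssumption {d p : ℕ} (c : Constants) (f : E d → E p) : Prop where
  flatHolder : ∀ m : Fin p, IsFlatHolder c.ς c.τ c.L (fun x => f x m)
  bound : c.ς < holderOrder c.τ → ∀ (m : Fin p) (idx : Fin (c.ς + 1) → Fin d) (x : E d),
    |partialDeriv (c.ς + 1) idx (fun x => f x m) x| ≤ c.derBound

/-- The covariance matrix `E[ε ε^T]` of a centered law. -/
def covMat {p : ℕ} (ν : Measure (E p)) : Matrix (Fin p) (Fin p) ℝ :=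
  Matrix.of fun m₁ m₂ => ∫ e, e m₁ * e m₂ ∂ν

/-- The mixed fourth moment `E[ε_{m₁} ε_{m₂} ε_{m₃} ε_{m₄}]`. -/
def fourthMoment {p : ℕ} (ν : Measure (E p)) (m₁ m₂ m₃ m₄ : Fin p) : ℝ :=
  ∫ e, e m₁ * e m₂ * e m₃ * e m₄ ∂ν

/-- The assumption on the laws of the independent disturbances. The moment bound makes all the
other moments finite. -/
structure NoiseAssumption {d p n : ℕ} (c : Constants) (X : ℕ → E d)
    (ν : Fin n → Measure (E p)) : Prop where
  prob : ∀ i, IsProbabilityMeasure (ν i)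
  moment : ∀ i m, ∫⁻ e, ENNReal.ofReal (|e m| ^ (4 + c.δ)) ∂(ν i) ≤ ENNReal.ofReal c.momBound
  mean_zero : ∀ i m, ∫ e, e m ∂(ν i) = 0
  lip_cov : ∀ (i j : Fin n) (m₁ m₂ : Fin p),
    |covMat (ν i) m₁ m₂ - covMat (ν j) m₁ m₂| ≤ c.lip * ‖X i - X j‖
  lip_fourth : ∀ (i j : Fin n) (m₁ m₂ m₃ m₄ : Fin p),
    |fourthMoment (ν i) m₁ m₂ m₃ m₄ - fourthMoment (ν j) m₁ m₂ m₃ m₄| ≤ c.lip * ‖X i - X j‖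
  var_low : ∀ i m, c.varLow ≤ covMat (ν i) m m

/-- The class `𝒢` of models at sample size `n`, with design points `X` and constants `c`. -/
def modelClass {d : ℕ} (p : ℕ) (c : Constants) (X : ℕ → E d) (n : ℕ) : Set (Model d p n) :=
  {w | RegressionAssumption c w.f ∧ NoiseAssumption c X w.ν}

/-- The joint law of the disturbances in the model `w`. -/
def Model.noiseLaw {d p n : ℕ} (w : Model d p n) : Measure (Fin n → E p) := Measure.pi w.ν

/-- The responses `Y_i = f(X_i) + ε_i`. -/
def Model.response {d p n : ℕ} (w : Model d p n) (X : ℕ → E d) (ε : Fin n → E p) :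
    Fin n → E p :=
  fun i => w.f (X i) + ε i

/-- `E_w[φ(Y)]` for a nonnegative statistic `φ` of the sample `Y = (Y_1, …, Y_n)`. -/
def Model.expect {d p n : ℕ} (w : Model d p n) (X : ℕ → E d) (φ : (Fin n → E p) → ℝ) : ℝ≥0∞ :=
  ∫⁻ ε, ENNReal.ofReal (φ (w.response X ε)) ∂w.noiseLaw

/-- The distance `ρ(w, H₀) = sup_{i, m} [f_m(X_i)]_+` to the null hypothesis. -/
def distNull {d p : ℕ} (X : ℕ → E d) (f : E d → E p) : ℝ≥0∞ :=
  ⨆ (i : ℕ) (m : Fin p), ENNReal.ofReal (f (X i) m)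

/-! ### The test -/

/-- Everything the test is computed from, besides the responses: the design points, the kernel,
the bandwidth values `hmax * a ^ k`, `k = 0, …, N n`, the sets of test points `I n k` for the
bandwidth `hmax * a ^ k`, the variance estimators (statistics of the responses), the function `g₀`
with its scale `β`, the level `α`, and the moment selection parameter `γ`. Observations are
indexed from `0`: the sample of size `n` has the design points `X 0, …, X (n - 1)`. -/
structure Setup (d p : ℕ) where
  X : ℕ → E d
  K : E d → ℝ
  hmax : ℝ
  a : ℝ
  N : ℕ → ℕ
  I : (n : ℕ) → ℕ → Finset (Fin n)
  sigmaHat : (n : ℕ) → Fin n → (Fin n → E p) → Matrix (Fin p) (Fin p) ℝ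
  g₀ : ℝ → ℝ
  β : ℕ → ℝ
  α : ℝ
  γ : ℕ → ℝ

namespace Setup

variable {d p : ℕ} (D : Setup d p)

/-- The `k`-th bandwidth value. -/
def bw (k : ℕ) : ℝ := D.hmax * D.a ^ k

/-- The minimal bandwidth value. -/
def hmin (n : ℕ) : ℝ := D.bw (D.N n)

/-- `K_h(x) = K(x / h) / h ^ d`. -/
def Kh (h : ℝ) (x : E d) : ℝ := D.K (h⁻¹ • x) / h ^ d

/-- The weights `w_h(X_i, X_j)`. -/
def weight (n : ℕ) (h : ℝ) (i j : Fin n) : ℝ :=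
  D.Kh h (D.X i - D.X j) / ∑ k : Fin n, D.Kh h (D.X i - D.X k)

/-- The index set of the test statistic: triples of a test point, a component, and (the exponent
of) a bandwidth value. -/
def S (n : ℕ) : Finset (Fin n × Fin p × ℕ) :=
  (Finset.univ ×ˢ Finset.univ ×ˢ Finset.range (D.N n + 1)).filter fun s => s.1 ∈ D.I n s.2.2

/-- The kernel estimator with index `s = (i, m, k)` applied to the vectors `y_1, …, y_n`. -/
def smooth (n : ℕ) (y : Fin n → E p) (s : Fin n × Fin p × ℕ) : ℝ :=
  ∑ j : Fin n, D.weight n (D.bw s.2.2) s.1 j * y j s.2.1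

/-- The estimated standard deviation `V̂_s` of the kernel estimator. -/
def Vhat (n : ℕ) (y : Fin n → E p) (s : Fin n × Fin p × ℕ) : ℝ :=
  Real.sqrt (∑ j : Fin n,
    D.weight n (D.bw s.2.2) s.1 j ^ 2 * D.sigmaHat n j y s.2.1 s.2.1)

/-- The maximum of `v` over the finite index set `A` (and `0` if `A` is empty). -/
def maxOver {ι : Type} (A : Finset ι) (v : ι → ℝ) : ℝ :=
  if h : A.Nonempty then A.sup' h v else 0

/-- The test statistic `T̂`. -/
def That (n : ℕ) (y : Fin n → E p) : ℝ :=
  maxOver (D.S n) fun s => D.smooth n y s / D.Vhat n y s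

/-- The conditional law, given the responses `y`, of the simulated sample: independent vectors
`Ỹ_i ∼ N(0, Σ̂_i)`. -/
def simLaw (n : ℕ) (y : Fin n → E p) : Measure (Fin n → E p) :=
  Measure.pi fun i => multivariateGaussian 0 (D.sigmaHat n i y)

/-- The statistic computed from the simulated sample `z`, with the maximum over `A`. -/
def simStat (n : ℕ) (A : Finset (Fin n × Fin p × ℕ)) (y z : Fin n → E p) : ℝ :=
  maxOver A fun s => D.smooth n z s / D.Vhat n y s

/-- The critical value at level `q` from the maximum over `A`: the (smallest) solution `c` of
`E[g₀((T - c) / β) | Y = y] = q`, where `T` is the simulated statistic. -/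
def crit (n : ℕ) (A : Finset (Fin n × Fin p × ℕ)) (q : ℝ) (y : Fin n → E p) : ℝ :=
  sInf {c : ℝ | ∫ z, D.g₀ ((D.simStat n A y z - c) / D.β n) ∂(D.simLaw n y) = q}

/-- The plug-in critical value `c_q^{PIA}`. -/
def critPIA (n : ℕ) (q : ℝ) (y : Fin n → E p) : ℝ := D.crit n (D.S n) q y

/-- The set `S^{RMS}` selected by the pretest. -/
def SRMS (n : ℕ) (y : Fin n → E p) : Finset (Fin n × Fin p × ℕ) :=
  (D.S n).filter fun s =>
    -2 * (D.critPIA n (1 - D.γ n) y + D.β n) < D.smooth n y s / D.Vhat n y s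

/-- The plug-in test function at `T̂`: the probability that the plug-in test accepts the null
hypothesis when the responses are `y`. -/
def gPIA (n : ℕ) (y : Fin n → E p) : ℝ :=
  D.g₀ ((D.That n y - D.critPIA n (1 - D.α) y) / D.β n)

open Classical in
/-- The RMS test function at `T̂`: the probability that the RMS test accepts the null hypothesis
when the responses are `y`. The test accepts if the pretest selects nothing. -/
def gRMS (n : ℕ) (y : Fin n → E p) : ℝ :=
  if (D.SRMS n y).Nonempty then
    D.g₀ ((D.That n y - D.crit n (D.SRMS n y) (1 - D.α + 2 * D.γ n) y) / D.β n)
  else 1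

/-! ### The assumptions on the test and on the design -/

/-- The number `M_h(X_i)` of observations `j` with `‖X_j - X_i‖ ≤ h`. -/
def ballCount (n : ℕ) (h : ℝ) (i : ℕ) : ℕ :=
  Nat.card {j : Fin n // ‖D.X j - D.X i‖ ≤ h}

/-- Design points: nonstochastic, of norm less than `hmax`, and with the numbers of points in the
balls of radius `h` proportional to `n h ^ d`. -/
structure DesignAssumption : Prop where
  bounded : ∀ i : ℕ, ‖D.X i‖ < D.hmax
  count : ∃ C₁ C₂ : ℝ, 0 < C₁ ∧ C₁ < C₂ ∧ ∀ᶠ n : ℕ in atTop, ∀ i k : ℕ, k ≤ D.N n →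
    C₁ * n * D.bw k ^ d ≤ D.ballCount n (D.bw k) i ∧
      (D.ballCount n (D.bw k) i : ℝ) ≤ C₂ * n * D.bw k ^ d

/-- Bandwidth values. -/
structure BandwidthAssumption : Prop where
  a_pos : 0 < D.a
  a_lt_one : D.a < 1
  hmin_tendsto : Tendsto D.hmin atTop (𝓝 0)
  card_le : ∃ C : ℝ, 0 < C ∧ ∀ᶠ n : ℕ in atTop, (D.N n : ℝ) + 1 ≤ C * Real.log n

/-- Variance estimators: measurable, positive semidefinite, and with
`max_i ‖Σ̂_i - Σ_i‖ = o_p(n ^ (-κ))` in the spectral norm, uniformly over the set `𝒲 n` of models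
at sample size `n`. -/
structure VarianceAssumption (κ : ℝ) (𝒲 : (n : ℕ) → Set (Model d p n)) : Prop where
  measurable : ∀ n i m₁ m₂, Measurable fun y => D.sigmaHat n i y m₁ m₂
  posSemidef : ∀ n i y, (D.sigmaHat n i y).PosSemidef
  consistent : ∀ η : ℝ, 0 < η → Tendsto (fun n : ℕ => ⨆ w ∈ 𝒲 n, w.noiseLaw
      {ε | ∃ i : Fin n, η * (n : ℝ) ^ (-κ) < ‖Matrix.toEuclideanCLM (𝕜 := ℝ)
        (D.sigmaHat n i (w.response D.X ε) - covMat (w.ν i))‖}) atTop (𝓝 0)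

/-- The kernel. -/
structure KernelAssumption : Prop where
  nonneg : ∀ x, 0 ≤ D.K x
  support : ∀ x, 1 < ‖x‖ → D.K x = 0
  le_one : ∀ x, D.K x ≤ 1
  lower : ∃ C : ℝ, 0 < C ∧ C < 1 ∧ ∀ x, ‖x‖ ≤ 1 / 2 → C ≤ D.K x

/-- The function `g₀` and the scale `β_n`. -/
structure TestFunctionAssumption : Prop where
  differentiable : ∀ k : ℕ, k < 3 → Differentiable ℝ (iteratedDeriv k D.g₀)
  antitone : Antitone D.g₀
  mem_Icc : ∀ x, D.g₀ x ∈ Set.Icc (0 : ℝ) 1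
  eq_one : ∀ x ≤ 0, D.g₀ x = 1
  eq_zero : ∀ x, 1 ≤ x → D.g₀ x = 0
  β_pos : ∀ n, 0 < D.β n
  β_le : ∃ C : ℝ, 0 < C ∧ ∀ n, D.β n ≤ C
  rate : Tendsto (fun n : ℕ => Real.log n ^ 4 / (D.β n ^ 10 * D.hmin n ^ (3 * d) * n))
    atTop (𝓝 0)

/-- The sets of test points. -/
structure TestPointAssumption : Prop where
  separated : ∀ n k : ℕ, k ≤ D.N n → ∀ i ∈ D.I n k, ∀ j ∈ D.I n k, i ≠ j →
    2 * D.bw k < ‖D.X i - D.X j‖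
  covering : ∀ n k : ℕ, k ≤ D.N n → ∀ i : Fin n, ∃ j ∈ D.I n k, ‖D.X i - D.X j‖ ≤ 2 * D.bw k

/-- The level `α ∈ (0, 1)`, and `0 < γ_n < α / 2` with `γ_n` bounded away from `α / 2` (for
instance `γ_n` constant, or `γ_n → 0`). -/
structure LevelAssumption : Prop where
  α_pos : 0 < D.α
  α_lt_one : D.α < 1
  γ_pos : ∀ n, 0 < D.γ n
  γ_le : ∃ b : ℝ, b < D.α / 2 ∧ ∀ n, D.γ n ≤ b

end Setup

end CMITest

end

open CMITest

/-! One coarse bandwidth, fixed as `n` grows, already detects the alternative, and no Gaussian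
approximation of the noise is needed. Some component of `f₀` is positive at a design point. By
continuity it stays above some `ρ > 0` on a whole kernel window of a small fixed bandwidth
(`exists_bandwidth_lower_bound`), so the smoothed signal there is at least `a n * ρ`. The squared
weights sum to `O(1/n)` (`exists_sum_sq_weight_le`). Hence Chebyshev's inequality keeps the smoothed
noise below half the signal outside an event of probability `O(1 / (n a_n²))`, uniformly over the
noise laws. Where the variance estimators are also close to the truth, the estimated deviation is
`O(n^{-1/2})`, and the studentized estimator is at least a constant times `√n a_n`, which dominates
`√(log n)`. The critical values are no larger than `√(6 log n)` for large `n`, whatever the sample: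
given the data, each simulated coordinate is sub-Gaussian with parameter at most one, and a union
bound over the polynomially many indices suffices (`one_sub_le_simAccept`,
`tendsto_card_S_mul_exp`). This covers every subset of `S`, hence the selected one. That subset
contains the detecting index because, by Gaussian symmetry, the pretest critical value is at least
`-β_n` (`simAccept_le_half`), so the selection threshold is not positive. Measurability and bounds
both rest on `crit_le_iff`, which turns statements on critical values into statements on the
conditional expectation `simAccept`. -/

namespace CMITest

/-! ### Measurability of the matrix square root. -/

section MatrixSqrt
open scoped MatrixOrder Matrix.Norms.L2Operator

theorem continuousOn_matrix_sqrt (p : ℕ) :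
    ContinuousOn (fun S : Matrix (Fin p) (Fin p) ℝ => CFC.sqrt S) {S | S.PosSemidef} := by
  have h := CFC.continuousOn_sqrt (A := Matrix (Fin p) (Fin p) ℝ)
  simpa only [Matrix.nonneg_iff_posSemidef] using h

end MatrixSqrt

-- The square root is continuous on the positive semidefinite cone, and `S` factors measurably
-- through that cone. This makes the simulated law depend measurably on the data.
open scoped MatrixOrder in
theorem measurable_matrix_sqrt_apply {Ω : Type*} [MeasurableSpace Ω] {p : ℕ}
    {S : Ω → Matrix (Fin p) (Fin p) ℝ} (hS : ∀ i j, Measurable fun ω => S ω i j)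
    (hpos : ∀ ω, (S ω).PosSemidef) (i j : Fin p) :
    Measurable fun ω => CFC.sqrt (S ω) i j := by
  let _ : MeasurableSpace (Matrix (Fin p) (Fin p) ℝ) :=
    inferInstanceAs (MeasurableSpace (Fin p → Fin p → ℝ))
  have : BorelSpace (Matrix (Fin p) (Fin p) ℝ) :=
    inferInstanceAs (BorelSpace (Fin p → Fin p → ℝ))
  have hSm : Measurable S := measurable_pi_lambda _ fun i => measurable_pi_lambda _ fun j => hS i j
  have h1 : Continuous fun A : {A : Matrix (Fin p) (Fin p) ℝ | A.PosSemidef} =>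
      CFC.sqrt (A : Matrix (Fin p) (Fin p) ℝ) :=
    continuousOn_iff_continuous_domRestrict.1 (continuousOn_matrix_sqrt p)
  have h2 : Continuous fun A : {A : Matrix (Fin p) (Fin p) ℝ | A.PosSemidef} =>
      CFC.sqrt (A : Matrix (Fin p) (Fin p) ℝ) i j :=
    h1.matrix_elem i j
  exact h2.measurable.comp (hSm.subtype_mk (h := hpos))

/-! ### Finite maxima; symmetry and tails of the simulated Gaussian sample. -/

theorem measurable_maxOver {Ω ι : Type} [MeasurableSpace Ω] (A : Finset ι) {v : Ω → ι → ℝ}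
    (hv : ∀ s, Measurable fun ω => v ω s) : Measurable fun ω => Setup.maxOver A (v ω) := by
  unfold Setup.maxOver
  split_ifs with h
  · have := Finset.measurable_sup' h (f := fun s ω => v ω s) fun s _ => hv s
    convert this using 1
    ext ω
    simp
  · exact measurable_const

theorem le_maxOver {ι : Type} {A : Finset ι} (v : ι → ℝ) {s : ι} (hs : s ∈ A) :
    v s ≤ Setup.maxOver A v := by
  have h : A.Nonempty := ⟨s, hs⟩
  simp only [Setup.maxOver, h, dif_pos]
  exact Finset.le_sup' v hs

/-- The condition `0 ≤ B` covers the default value `0` of the maximum over the empty set. -/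
theorem maxOver_le {ι : Type} {A : Finset ι} {v : ι → ℝ} {B : ℝ} (hB : 0 ≤ B)
    (h : ∀ s ∈ A, v s ≤ B) : Setup.maxOver A v ≤ B := by
  unfold Setup.maxOver
  split_ifs with hA
  · exact Finset.sup'_le _ _ h
  · exact hB

theorem map_neg_stdGaussian (k : ℕ) : (stdGaussian (E k)).map (fun x => -x) = stdGaussian (E k) :=
  stdGaussian_map (LinearIsometryEquiv.neg ℝ)

theorem map_neg_multivariateGaussian {k : ℕ} (S : Matrix (Fin k) (Fin k) ℝ) :
    (multivariateGaussian 0 S).map (fun x => -x) = multivariateGaussian 0 S := by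
  unfold multivariateGaussian
  rw [Measure.map_map (by fun_prop) (by fun_prop)]
  conv_rhs => rw [← map_neg_stdGaussian, Measure.map_map (by fun_prop) (by fun_prop)]
  congr 1
  ext x
  simp

theorem hasSubgaussianMGF_gaussianReal (v : NNReal) :
    HasSubgaussianMGF id v (gaussianReal 0 v) where
  integrable_exp_mul t := integrable_exp_mul_gaussianReal t
  mgf_le t := by simp [mgf_id_gaussianReal]

namespace Setup

variable {d p : ℕ} (D : Setup d p)

theorem measurable_smooth (n : ℕ) (s : Fin n × Fin p × ℕ) :
    Measurable fun y => D.smooth n y s := by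
  unfold smooth; fun_prop

theorem map_neg_simLaw (n : ℕ) (y : Fin n → E p) :
    (D.simLaw n y).map (fun z => -z) = D.simLaw n y := by
  unfold simLaw
  have h : ∀ i, ((multivariateGaussian 0 (D.sigmaHat n i y)).map fun x => -x)
      = multivariateGaussian 0 (D.sigmaHat n i y) := fun i => map_neg_multivariateGaussian _
  have := Measure.pi_map_pi (μ := fun i => multivariateGaussian 0 (D.sigmaHat n i y))
    (f := fun _ x => -x) (fun i => by fun_prop)
  simp_rw [h] at this
  exact this

instance (n : ℕ) (y : Fin n → E p) : IsProbabilityMeasure (D.simLaw n y) := by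
  unfold simLaw; infer_instance

theorem smooth_neg (n : ℕ) (z : Fin n → E p) (s : Fin n × Fin p × ℕ) :
    D.smooth n (-z) s = -D.smooth n z s := by
  simp [smooth]

theorem smooth_add (n : ℕ) (z z' : Fin n → E p) (s : Fin n × Fin p × ℕ) :
    D.smooth n (z + z') s = D.smooth n z s + D.smooth n z' s := by
  simp [smooth, mul_add, Finset.sum_add_distrib]

/-- Each simulated studentized estimator is negative with probability at most one half. -/
theorem simLaw_neg_le_half (n : ℕ) (y : Fin n → E p) (s : Fin n × Fin p × ℕ) :
    (D.simLaw n y).real {z | D.smooth n z s / D.Vhat n y s < 0} ≤ 1 / 2 := by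
  have hm : Measurable fun z => D.smooth n z s / D.Vhat n y s :=
    (D.measurable_smooth n s).div_const _
  have h1 : (D.simLaw n y).real {z | D.smooth n z s / D.Vhat n y s < 0}
      = (D.simLaw n y).real {z | 0 < D.smooth n z s / D.Vhat n y s} := by
    conv_lhs => rw [← D.map_neg_simLaw n y]
    rw [map_measureReal_apply (by fun_prop) (measurableSet_lt hm measurable_const)]
    congr 1
    ext z
    simp [smooth_neg, neg_div]
  have h2 : (D.simLaw n y).real {z | D.smooth n z s / D.Vhat n y s < 0}
      + (D.simLaw n y).real {z | 0 < D.smooth n z s / D.Vhat n y s} ≤ 1 := by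
    rw [← measureReal_union _ (measurableSet_lt measurable_const hm)]
    · exact measureReal_le_one
    · rw [Set.disjoint_left]
      exact fun z h h' => lt_asymm (a := D.smooth n z s / D.Vhat n y s) h h'
  linarith

/-- The estimator is a sum of independent centered Gaussians, whose variances add up to the square
of `Vhat`; semidefiniteness makes all summands nonnegative, so the truncation by `toNNReal` is
harmless. -/
theorem hasSubgaussianMGF_smooth (n : ℕ) (y : Fin n → E p)
    (hpos : ∀ i, (D.sigmaHat n i y).PosSemidef) (s : Fin n × Fin p × ℕ) :
    HasSubgaussianMGF (fun z => D.smooth n z s) (D.Vhat n y s ^ 2).toNNReal (D.simLaw n y) := by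
  have hdiag : ∀ i m, 0 ≤ D.sigmaHat n i y m m := fun i m => (hpos i).diag_nonneg
  have h1 : ∀ j : Fin n, HasSubgaussianMGF
      (fun x : E p => D.weight n (D.bw s.2.2) s.1 j * x s.2.1)
      (D.weight n (D.bw s.2.2) s.1 j ^ 2 * D.sigmaHat n j y s.2.1 s.2.1).toNNReal
      (multivariateGaussian 0 (D.sigmaHat n j y)) := by
    intro j
    have hmp := measurePreserving_eval_multivariateGaussian (μ := 0) (hpos j) (i := s.2.1)
    have h := hasSubgaussianMGF_gaussianReal (D.sigmaHat n j y s.2.1 s.2.1).toNNReal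
    have h' : HasSubgaussianMGF (fun x : E p => x s.2.1) (D.sigmaHat n j y s.2.1 s.2.1).toNNReal
        (multivariateGaussian 0 (D.sigmaHat n j y)) := by
      refine HasSubgaussianMGF.of_map (X := id) hmp.measurable.aemeasurable ?_
      rw [hmp.map_eq]
      exact h
    have h'' := h'.const_mul (D.weight n (D.bw s.2.2) s.1 j)
    rw [Real.toNNReal_mul (sq_nonneg _), Real.toNNReal_of_nonneg (sq_nonneg _)]
    exact h''
  have h2 : ∀ j : Fin n, HasSubgaussianMGF
      (fun z : Fin n → E p => D.weight n (D.bw s.2.2) s.1 j * z j s.2.1)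
      (D.weight n (D.bw s.2.2) s.1 j ^ 2 * D.sigmaHat n j y s.2.1 s.2.1).toNNReal
      (D.simLaw n y) := by
    intro j
    have hmp := measurePreserving_eval
      (fun i => multivariateGaussian 0 (D.sigmaHat n i y)) j
    refine HasSubgaussianMGF.of_map (Y := Function.eval j)
      (X := fun x : E p => D.weight n (D.bw s.2.2) s.1 j * x s.2.1) hmp.measurable.aemeasurable ?_
    simp only [simLaw]
    rw [hmp.map_eq]
    exact h1 j
  have h3 := HasSubgaussianMGF.sum_of_iIndepFun (μ := D.simLaw n y)
    (X := fun j z => D.weight n (D.bw s.2.2) s.1 j * z j s.2.1)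
    (iIndepFun_pi (X := fun j (x : E p) => D.weight n (D.bw s.2.2) s.1 j * x s.2.1)
      fun j => by fun_prop) (s := Finset.univ) fun j _ => h2 j
  have h4 : (D.Vhat n y s ^ 2).toNNReal = ∑ j : Fin n,
      (D.weight n (D.bw s.2.2) s.1 j ^ 2 * D.sigmaHat n j y s.2.1 s.2.1).toNNReal := by
    rw [Vhat, Real.sq_sqrt (Finset.sum_nonneg fun j _ => mul_nonneg (sq_nonneg _) (hdiag _ _)),
      Real.toNNReal_sum_of_nonneg fun j _ => mul_nonneg (sq_nonneg _) (hdiag _ _)]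
  rw [h4]
  exact h3

theorem simLaw_tail_le (n : ℕ) (y : Fin n → E p)
    (hpos : ∀ i, (D.sigmaHat n i y).PosSemidef) (s : Fin n × Fin p × ℕ) {B : ℝ} (hB : 0 < B) :
    (D.simLaw n y).real {z | B ≤ D.smooth n z s / D.Vhat n y s} ≤ Real.exp (-B ^ 2 / 2) := by
  have hV : 0 ≤ D.Vhat n y s := Real.sqrt_nonneg _
  rcases hV.eq_or_lt with h0 | h0
  -- If `Vhat` is zero, the quotient is zero by convention and cannot reach `B > 0`.
  · have : {z | B ≤ D.smooth n z s / D.Vhat n y s} = ∅ := by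
      ext z; simp [← h0, hB]
    rw [this]
    simpa using (Real.exp_pos _).le
  · have h := (D.hasSubgaussianMGF_smooth n y hpos s).measure_ge_le (mul_pos hB h0).le
    simp_rw [le_div_iff₀ h0]
    refine h.trans_eq ?_
    congr 1
    rw [Real.coe_toNNReal _ (sq_nonneg _)]
    field_simp

end Setup
end CMITest

/-! ### Critical values as generalized quantiles, and measurability of the tests. -/

namespace CMITest
namespace Setup

variable {d p : ℕ} (D : Setup d p)

theorem TestFunctionAssumption.continuous {D : Setup d p} (h : D.TestFunctionAssumption) :
    Continuous D.g₀ := by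
  have := (h.differentiable 0 (by norm_num)).continuous
  simpa [iteratedDeriv_zero] using this

/-- The conditional expectation `E[g₀((T_A - c) / β_n) | Y = y]`. -/
noncomputable def simAccept (n : ℕ) (A : Finset (Fin n × Fin p × ℕ)) (y : Fin n → E p) (c : ℝ) : ℝ :=
  ∫ z, D.g₀ ((D.simStat n A y z - c) / D.β n) ∂(D.simLaw n y)

theorem measurable_simStat (n : ℕ) (A : Finset (Fin n × Fin p × ℕ)) (y : Fin n → E p) :
    Measurable (D.simStat n A y) :=
  measurable_maxOver A fun s => (D.measurable_smooth n s).div_const _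

variable {D}

theorem measurable_simAccept_integrand (ht : D.TestFunctionAssumption) (n : ℕ)
    (A : Finset (Fin n × Fin p × ℕ)) (y : Fin n → E p) (c : ℝ) :
    Measurable fun z => D.g₀ ((D.simStat n A y z - c) / D.β n) :=
  ht.continuous.measurable.comp (((D.measurable_simStat n A y).sub_const c).div_const _)

theorem integrable_simAccept_integrand (ht : D.TestFunctionAssumption) (n : ℕ)
    (A : Finset (Fin n × Fin p × ℕ)) (y : Fin n → E p) (c : ℝ) :
    Integrable (fun z => D.g₀ ((D.simStat n A y z - c) / D.β n)) (D.simLaw n y) := by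
  refine Integrable.of_bound (measurable_simAccept_integrand ht n A y c).aestronglyMeasurable 1 ?_
  refine ae_of_all _ fun z => ?_
  rw [Real.norm_of_nonneg (ht.mem_Icc _).1]
  exact (ht.mem_Icc _).2

theorem simAccept_mono (ht : D.TestFunctionAssumption) (n : ℕ)
    (A : Finset (Fin n × Fin p × ℕ)) (y : Fin n → E p) : Monotone (D.simAccept n A y) := by
  intro c c' h
  refine integral_mono (integrable_simAccept_integrand ht n A y c)
    (integrable_simAccept_integrand ht n A y c') fun z => ht.antitone ?_
  have := ht.β_pos n
  gcongr

/-- Dominated convergence with bound `1`; continuity in `c` and both limits at infinity are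
instances. -/
theorem tendsto_simAccept (ht : D.TestFunctionAssumption) (n : ℕ)
    (A : Finset (Fin n × Fin p × ℕ)) (y : Fin n → E p) {l : Filter ℝ} [l.IsCountablyGenerated]
    {f : (Fin n → E p) → ℝ}
    (hf : ∀ z, Tendsto (fun c => D.g₀ ((D.simStat n A y z - c) / D.β n)) l (𝓝 (f z))) :
    Tendsto (D.simAccept n A y) l (𝓝 (∫ z, f z ∂(D.simLaw n y))) := by
  refine tendsto_integral_filter_of_dominated_convergence (fun _ => 1)
    (Eventually.of_forall fun c =>
      (measurable_simAccept_integrand ht n A y c).aestronglyMeasurable)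
    (Eventually.of_forall fun c => ae_of_all _ fun z => ?_) (integrable_const _)
    (ae_of_all _ hf)
  rw [Real.norm_of_nonneg (ht.mem_Icc _).1]
  exact (ht.mem_Icc _).2

theorem continuous_simAccept (ht : D.TestFunctionAssumption) (n : ℕ)
    (A : Finset (Fin n × Fin p × ℕ)) (y : Fin n → E p) : Continuous (D.simAccept n A y) := by
  rw [continuous_iff_continuousAt]
  intro c
  refine tendsto_simAccept ht n A y (f := fun z => D.g₀ ((D.simStat n A y z - c) / D.β n))
    fun z => ?_
  have := ht.continuous
  exact (Continuous.tendsto (by fun_prop) c)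

theorem tendsto_simAccept_atBot (ht : D.TestFunctionAssumption) (n : ℕ)
    (A : Finset (Fin n × Fin p × ℕ)) (y : Fin n → E p) :
    Tendsto (D.simAccept n A y) atBot (𝓝 0) := by
  have h := tendsto_simAccept ht n A y (l := atBot) (f := fun _ => 0) fun z => by
    refine tendsto_const_nhds.congr' ?_
    filter_upwards [eventually_le_atBot (D.simStat n A y z - D.β n)] with c hc
    rw [ht.eq_zero]
    rw [le_div_iff₀ (ht.β_pos n)]
    linarith
  simpa using h

theorem tendsto_simAccept_atTop (ht : D.TestFunctionAssumption) (n : ℕ)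
    (A : Finset (Fin n × Fin p × ℕ)) (y : Fin n → E p) :
    Tendsto (D.simAccept n A y) atTop (𝓝 1) := by
  have h := tendsto_simAccept ht n A y (l := atTop) (f := fun _ => 1) fun z => by
    refine tendsto_const_nhds.congr' ?_
    filter_upwards [eventually_ge_atTop (D.simStat n A y z)] with c hc
    rw [ht.eq_one]
    exact div_nonpos_of_nonpos_of_nonneg (by linarith) (ht.β_pos n).le
  simpa using h

/-- `simAccept` is continuous and nondecreasing in `c` and runs from `0` to `1`, so its level set at
`q` is nonempty, closed and bounded below. The infimum is therefore itself a solution, and the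
smallest one. -/
theorem crit_le_iff (ht : D.TestFunctionAssumption) (n : ℕ)
    (A : Finset (Fin n × Fin p × ℕ)) (y : Fin n → E p) {q : ℝ} (hq0 : 0 < q) (hq1 : q < 1)
    (t : ℝ) : D.crit n A q y ≤ t ↔ q ≤ D.simAccept n A y t := by
  have hcont := continuous_simAccept ht n A y
  have hmono := simAccept_mono ht n A y
  obtain ⟨b, hb⟩ :=
    ((tendsto_simAccept_atBot ht n A y).eventually (gt_mem_nhds hq0)).exists
  obtain ⟨b', hb'⟩ :=
    ((tendsto_simAccept_atTop ht n A y).eventually (lt_mem_nhds hq1)).exists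
  have hcrit : D.crit n A q y = sInf {c | D.simAccept n A y c = q} := rfl
  have hne : {c | D.simAccept n A y c = q}.Nonempty :=
    mem_range_of_exists_le_of_exists_ge hcont ⟨b, hb.le⟩ ⟨b', hb'.le⟩
  have hlow : ∀ c, q ≤ D.simAccept n A y c → b ≤ c := by
    intro c hc
    by_contra! h
    linarith [hmono h.le]
  have hbdd : BddBelow {c | D.simAccept n A y c = q} := ⟨b, fun c hc => hlow c (le_of_eq hc.symm)⟩
  have hclosed : IsClosed {c | D.simAccept n A y c = q} := isClosed_eq hcont continuous_const
  rw [hcrit]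
  constructor
  · intro h
    have hmem : D.simAccept n A y (sInf {c | D.simAccept n A y c = q}) = q :=
      hclosed.csInf_mem hne hbdd
    exact hmem.symm.le.trans (hmono h)
  · intro h
    obtain ⟨c, hc, hcq⟩ := intermediate_value_Icc (hlow t h) hcont.continuousOn ⟨hb.le, h⟩
    exact (csInf_le hbdd hcq).trans hc.2

theorem measurable_Vhat (hσ : ∀ n i m₁ m₂, Measurable fun y => D.sigmaHat n i y m₁ m₂) (n : ℕ)
    (s : Fin n × Fin p × ℕ) : Measurable fun y => D.Vhat n y s := by
  unfold Vhat
  have := fun i => hσ n i s.2.1 s.2.1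
  fun_prop

-- The simulated sample is the image of a standard Gaussian sample under the square roots of the
-- estimated covariances. This moves the dependence on `y` from the measure into a jointly
-- measurable integrand.
open scoped MatrixOrder in
theorem measurable_simAccept (ht : D.TestFunctionAssumption)
    (hσ : ∀ n i m₁ m₂, Measurable fun y => D.sigmaHat n i y m₁ m₂)
    (hpos : ∀ n i y, (D.sigmaHat n i y).PosSemidef) (n : ℕ)
    (A : Finset (Fin n × Fin p × ℕ)) (c : ℝ) : Measurable fun y => D.simAccept n A y c := by
  let R : (Fin n → E p) → (Fin n → E p) → Fin n → E p := fun y u i =>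
    0 + Matrix.toEuclideanCLM (𝕜 := ℝ) (CFC.sqrt (D.sigmaHat n i y)) (u i)
  have hR : ∀ y, Measurable (R y) := fun y => by fun_prop
  have hlaw : ∀ y, D.simLaw n y
      = (Measure.pi fun _ : Fin n => stdGaussian (E p)).map (R y) := fun y =>
    (Measure.pi_map_pi (μ := fun _ : Fin n => stdGaussian (E p)) (f := fun i x =>
      0 + Matrix.toEuclideanCLM (𝕜 := ℝ) (CFC.sqrt (D.sigmaHat n i y)) x)
      (fun i => by fun_prop)).symm
  have hR2 : ∀ i m, Measurable fun yu : (Fin n → E p) × (Fin n → E p) => R yu.1 yu.2 i m := by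
    intro i m
    have h : (fun yu : (Fin n → E p) × (Fin n → E p) => R yu.1 yu.2 i m) =
        fun yu => ∑ k, CFC.sqrt (D.sigmaHat n i yu.1) m k * yu.2 i k := by
      ext yu
      simp [R, Matrix.ofLp_toEuclideanCLM, Matrix.mulVec, dotProduct]
    rw [h]
    have hs := fun k => measurable_matrix_sqrt_apply (hσ n i) (hpos n i) m k
    exact Finset.measurable_sum _ fun k _ => ((hs k).comp measurable_fst).mul (by fun_prop)
  have hstat : Measurable fun yu : (Fin n → E p) × (Fin n → E p) =>
      D.simStat n A yu.1 (R yu.1 yu.2) := by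
    refine measurable_maxOver A fun s => Measurable.div ?_
      ((measurable_Vhat hσ n s).comp measurable_fst)
    unfold smooth
    exact Finset.measurable_sum _ fun j _ => (hR2 j s.2.1).const_mul _
  have hint : ∀ y, D.simAccept n A y c = ∫ u, D.g₀ ((D.simStat n A y (R y u) - c) / D.β n)
      ∂(Measure.pi fun _ : Fin n => stdGaussian (E p)) := by
    intro y
    rw [simAccept, hlaw, integral_map (hR y).aemeasurable
      (measurable_simAccept_integrand ht n A y c).aestronglyMeasurable]
  simp_rw [hint]
  refine (StronglyMeasurable.integral_prod_right (f := fun y u =>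
    D.g₀ ((D.simStat n A y (R y u) - c) / D.β n)) ?_).measurable
  exact (ht.continuous.measurable.comp ((hstat.sub_const c).div_const _)).stronglyMeasurable

theorem measurable_crit (ht : D.TestFunctionAssumption)
    (hσ : ∀ n i m₁ m₂, Measurable fun y => D.sigmaHat n i y m₁ m₂)
    (hpos : ∀ n i y, (D.sigmaHat n i y).PosSemidef) (n : ℕ)
    (A : Finset (Fin n × Fin p × ℕ)) {q : ℝ} (hq0 : 0 < q) (hq1 : q < 1) :
    Measurable (D.crit n A q) := by
  refine measurable_of_Iic fun t => ?_
  have : D.crit n A q ⁻¹' Set.Iic t = {y | q ≤ D.simAccept n A y t} := by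
    ext y
    exact crit_le_iff ht n A y hq0 hq1 t
  rw [this]
  exact measurableSet_le measurable_const (measurable_simAccept ht hσ hpos n A t)

theorem measurable_studentized (hσ : ∀ n i m₁ m₂, Measurable fun y => D.sigmaHat n i y m₁ m₂)
    (n : ℕ) (s : Fin n × Fin p × ℕ) : Measurable fun y => D.smooth n y s / D.Vhat n y s :=
  (D.measurable_smooth n s).div (measurable_Vhat hσ n s)

theorem measurable_That (hσ : ∀ n i m₁ m₂, Measurable fun y => D.sigmaHat n i y m₁ m₂)
    (n : ℕ) : Measurable (D.That n) :=
  measurable_maxOver (D.S n) (measurable_studentized hσ n)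

theorem LevelAssumption.γ_lt (hl : D.LevelAssumption) (n : ℕ) : D.γ n < D.α / 2 := by
  obtain ⟨b, hb, h⟩ := hl.γ_le
  exact (h n).trans_lt hb

theorem measurable_gPIA (ht : D.TestFunctionAssumption) (hl : D.LevelAssumption)
    (hσ : ∀ n i m₁ m₂, Measurable fun y => D.sigmaHat n i y m₁ m₂)
    (hpos : ∀ n i y, (D.sigmaHat n i y).PosSemidef) (n : ℕ) : Measurable (D.gPIA n) := by
  have h1 := hl.α_pos
  have h2 := hl.α_lt_one
  exact ht.continuous.measurable.comp (((measurable_That hσ n).sub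
    (measurable_crit ht hσ hpos n (D.S n) (by linarith) (by linarith))).div_const _)

theorem measurable_gRMS (ht : D.TestFunctionAssumption) (hl : D.LevelAssumption)
    (hσ : ∀ n i m₁ m₂, Measurable fun y => D.sigmaHat n i y m₁ m₂)
    (hpos : ∀ n i y, (D.sigmaHat n i y).PosSemidef) (n : ℕ) : Measurable (D.gRMS n) := by
  classical
  have h1 := hl.α_pos
  have h2 := hl.α_lt_one
  have h3 := hl.γ_lt n
  have h4 := hl.γ_pos n
  let G : Finset (Fin n × Fin p × ℕ) → (Fin n → E p) → ℝ := fun A y =>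
    if A.Nonempty then
      D.g₀ ((D.That n y - D.crit n A (1 - D.α + 2 * D.γ n) y) / D.β n) else 1
  have hG : ∀ A, Measurable (G A) := by
    intro A
    by_cases hA : A.Nonempty
    · simp only [G, hA, if_true]
      exact ht.continuous.measurable.comp (((measurable_That hσ n).sub
        (measurable_crit ht hσ hpos n A (by linarith) (by linarith))).div_const _)
    · simp only [G, hA, if_false]
      exact measurable_const
  have hsel : ∀ s, MeasurableSet {y | s ∈ D.SRMS n y} := by
    intro s
    by_cases hs : s ∈ D.S n
    · simp only [SRMS, Finset.mem_filter, hs, true_and]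
      have hc : Measurable (D.critPIA n (1 - D.γ n)) :=
        measurable_crit ht hσ hpos n (D.S n) (by linarith) (by linarith)
      exact measurableSet_lt ((hc.add_const _).const_mul _) (measurable_studentized hσ n s)
    · simp [SRMS, hs]
  have hset : ∀ A, MeasurableSet {y | D.SRMS n y = A} := by
    intro A
    have : {y | D.SRMS n y = A} =
        ⋂ s, {y | s ∈ D.SRMS n y ↔ s ∈ A} := by
      ext y; simp [Finset.ext_iff]
    rw [this]
    refine MeasurableSet.iInter fun s => ?_
    by_cases hs : s ∈ A
    · simpa [hs] using hsel s
    · simp only [hs, iff_false]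
      exact (hsel s).compl
  -- The selected set takes finitely many values, each on a measurable event, and on each event the
  -- critical value is that of a fixed index set.
  have hsum : D.gRMS n = fun y => ∑ A ∈ (D.S n).powerset,
      {y | D.SRMS n y = A}.indicator (G A) y := by
    ext y
    rw [Finset.sum_eq_single (D.SRMS n y)]
    · simp [gRMS, G]
    · intro A _ hA
      have : y ∉ {y | D.SRMS n y = A} := fun h => hA (Eq.symm h)
      exact Set.indicator_of_notMem this _
    · intro h
      exact absurd (Finset.mem_powerset.2 (Finset.filter_subset _ _)) h
  rw [hsum]
  exact Finset.measurable_sum _ fun A _ => (hG A).indicator (hset A)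

/-- The integrand equals `1` unless some coordinate reaches `B`; a union bound with the sub-Gaussian
tails controls this event. -/
theorem one_sub_le_simAccept (ht : D.TestFunctionAssumption) (n : ℕ)
    (A : Finset (Fin n × Fin p × ℕ)) (y : Fin n → E p)
    (hpos : ∀ i, (D.sigmaHat n i y).PosSemidef) {B : ℝ} (hB : 0 < B) :
    1 - A.card * Real.exp (-B ^ 2 / 2) ≤ D.simAccept n A y B := by
  classical
  let U : Fin n × Fin p × ℕ → Set (Fin n → E p) :=
    fun s => {z | B ≤ D.smooth n z s / D.Vhat n y s}
  have hU : ∀ s, MeasurableSet (U s) := fun s =>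
    measurableSet_le measurable_const ((D.measurable_smooth n s).div_const _)
  have hI : ∀ s, Integrable ((U s).indicator fun _ => (1 : ℝ)) (D.simLaw n y) := fun s =>
    (integrable_const _).indicator (hU s)
  have h1 : ∀ z, 1 - ∑ s ∈ A, (U s).indicator (fun _ => (1 : ℝ)) z
      ≤ D.g₀ ((D.simStat n A y z - B) / D.β n) := by
    intro z
    have hnn : ∀ s, 0 ≤ (U s).indicator (fun _ => (1 : ℝ)) z :=
      fun s => Set.indicator_nonneg (fun _ _ => zero_le_one) z
    by_cases h : ∃ s ∈ A, z ∈ U s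
    · obtain ⟨s, hs, hz⟩ := h
      have h2 := Finset.single_le_sum (fun s _ => hnn s) hs
      rw [Set.indicator_of_mem hz] at h2
      linarith [(ht.mem_Icc ((D.simStat n A y z - B) / D.β n)).1]
    · push Not at h
      have h3 : D.simStat n A y z ≤ B :=
        maxOver_le hB.le fun s hs => (not_le.1 (h s hs)).le
      rw [ht.eq_one _ (div_nonpos_of_nonpos_of_nonneg (by linarith) (ht.β_pos n).le)]
      linarith [Finset.sum_nonneg fun s (_ : s ∈ A) => hnn s]
  have h2 := integral_mono ((integrable_const 1).sub (integrable_finsetSum A fun s _ => hI s))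
    (integrable_simAccept_integrand ht n A y B) h1
  have h3 : ∫ z, (1 - ∑ s ∈ A, (U s).indicator (fun _ => (1 : ℝ)) z) ∂(D.simLaw n y)
      = 1 - ∑ s ∈ A, (D.simLaw n y).real (U s) := by
    rw [integral_sub (integrable_const _) (integrable_finsetSum A fun s _ => hI s),
      integral_finsetSum A fun s _ => hI s]
    simp [integral_indicator_const, hU]
  have h4 : ∑ s ∈ A, (D.simLaw n y).real (U s) ≤ A.card * Real.exp (-B ^ 2 / 2) := by
    rw [← nsmul_eq_mul]
    exact Finset.sum_le_card_nsmul _ _ _ fun s _ => D.simLaw_tail_le n y hpos s hB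
  have h5 : 1 - ∑ s ∈ A, (D.simLaw n y).real (U s) ≤ D.simAccept n A y B := by
    rw [← h3]; exact h2
  linarith

/-- For `t ≤ -β_n` the integrand vanishes unless the maximum is negative. Then every coordinate is
negative, and for a single symmetric one this has probability at most one half. -/
theorem simAccept_le_half (ht : D.TestFunctionAssumption) (n : ℕ)
    {A : Finset (Fin n × Fin p × ℕ)} (hA : A.Nonempty) (y : Fin n → E p) {t : ℝ}
    (h : t ≤ -D.β n) : D.simAccept n A y t ≤ 1 / 2 := by
  obtain ⟨s, hs⟩ := hA
  have hU : MeasurableSet {z | D.smooth n z s / D.Vhat n y s < 0} :=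
    measurableSet_lt ((D.measurable_smooth n s).div_const _) measurable_const
  refine le_trans ?_ (D.simLaw_neg_le_half n y s)
  rw [← integral_indicator_one hU]
  refine integral_mono (integrable_simAccept_integrand ht n A y t)
    ((integrable_const 1).indicator hU) fun z => ?_
  by_cases hz : z ∈ {z | D.smooth n z s / D.Vhat n y s < 0}
  · rw [Set.indicator_of_mem hz]
    exact (ht.mem_Icc _).2
  · rw [Set.indicator_of_notMem hz]
    refine (ht.eq_zero _ ?_).le
    rw [le_div_iff₀ (ht.β_pos n)]
    have := le_maxOver (fun s => D.smooth n z s / D.Vhat n y s) hs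
    have hz' : ¬ D.smooth n z s / D.Vhat n y s < 0 := hz
    simp only [simStat]
    linarith

end Setup
end CMITest

/-! ### Moments of the disturbances and Chebyshev's inequality. -/

namespace CMITest

theorem sq_le_one_add_abs_rpow {q : ℝ} (hq : 2 ≤ q) (x : ℝ) : x ^ 2 ≤ 1 + |x| ^ q := by
  have h0 : 0 ≤ |x| ^ q := Real.rpow_nonneg (abs_nonneg x) q
  rcases le_total |x| 1 with h | h
  · nlinarith [abs_nonneg x, sq_abs x]
  · have := Real.rpow_le_rpow_of_exponent_le h hq
    rw [Real.rpow_two, sq_abs] at this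
    linarith

namespace NoiseAssumption

variable {d p n : ℕ} {c : Constants} {X : ℕ → E d} {ν : Fin n → Measure (E p)}

theorem integrable_rpow (h : NoiseAssumption c X ν) (i : Fin n) (m : Fin p) :
    Integrable (fun e : E p => |e m| ^ (4 + c.δ)) (ν i) := by
  refine ⟨Measurable.aestronglyMeasurable (by fun_prop), ?_⟩
  rw [hasFiniteIntegral_iff_ofReal (ae_of_all _ fun e => by positivity)]
  exact (h.moment i m).trans_lt ENNReal.ofReal_lt_top

theorem integral_rpow_le (h : NoiseAssumption c X ν) (hc : c.Admissible) (i : Fin n)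
    (m : Fin p) : ∫ e : E p, |e m| ^ (4 + c.δ) ∂(ν i) ≤ c.momBound := by
  rw [integral_eq_lintegral_of_nonneg_ae (ae_of_all _ fun e => by positivity)
    (h.integrable_rpow i m).aestronglyMeasurable]
  exact ENNReal.toReal_le_of_le_ofReal hc.momBound_pos.le (h.moment i m)

theorem integrable_sq (h : NoiseAssumption c X ν) (hc : c.Admissible) (i : Fin n) (m : Fin p) :
    Integrable (fun e : E p => e m ^ 2) (ν i) := by
  have := h.prob i
  refine ((integrable_const 1).add (h.integrable_rpow i m)).mono'
    (Measurable.aestronglyMeasurable (by fun_prop)) (ae_of_all _ fun e => ?_)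
  rw [Real.norm_of_nonneg (sq_nonneg _)]
  exact sq_le_one_add_abs_rpow (by linarith [hc.δ_pos]) _

theorem covMat_diag_le (h : NoiseAssumption c X ν) (hc : c.Admissible) (i : Fin n)
    (m : Fin p) : covMat (ν i) m m ≤ 1 + c.momBound := by
  have := h.prob i
  have h1 : covMat (ν i) m m = ∫ e : E p, e m ^ 2 ∂(ν i) := by
    simp [covMat, sq]
  have h2 : ∫ e : E p, e m ^ 2 ∂(ν i) ≤ ∫ e : E p, (1 + |e m| ^ (4 + c.δ)) ∂(ν i) :=
    integral_mono (h.integrable_sq hc i m)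
      ((integrable_const 1).add (h.integrable_rpow i m))
      fun e => sq_le_one_add_abs_rpow (by linarith [hc.δ_pos]) _
  rw [integral_add (integrable_const 1) (h.integrable_rpow i m)] at h2
  have h3 := h.integral_rpow_le hc i m
  simp at h2
  linarith

theorem memLp_two (h : NoiseAssumption c X ν) (hc : c.Admissible) (i : Fin n) (m : Fin p) :
    MemLp (fun e : E p => e m) 2 (ν i) :=
  (memLp_two_iff_integrable_sq (Measurable.aestronglyMeasurable (by fun_prop))).2
    (h.integrable_sq hc i m)

/-- Chebyshev's inequality for weighted sums of the disturbances. -/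
theorem measure_weighted_sum_ge_le (h : NoiseAssumption c X ν) (hc : c.Admissible)
    (ω : Fin n → ℝ) (m : Fin p) {t : ℝ} (ht : 0 < t) :
    Measure.pi ν {ε | t ≤ |∑ j, ω j * ε j m|}
      ≤ ENNReal.ofReal ((∑ j, ω j ^ 2) * (1 + c.momBound) / t ^ 2) := by
  have := h.prob
  have hL : ∀ j, MemLp (fun e : E p => ω j * e m) 2 (ν j) := fun j =>
    (h.memLp_two hc j m).const_mul _
  have hL' : ∀ j, MemLp (fun ε : Fin n → E p => ω j * ε j m) 2 (Measure.pi ν) := fun j =>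
    (hL j).comp_measurePreserving (measurePreserving_eval ν j)
  have hvar : Var[∑ j, fun ε : Fin n → E p => ω j * ε j m; Measure.pi ν]
      ≤ (∑ j, ω j ^ 2) * (1 + c.momBound) := by
    rw [variance_sum_pi (X := fun j (e : E p) => ω j * e m) hL, Finset.sum_mul]
    refine Finset.sum_le_sum fun j _ => ?_
    rw [variance_const_mul]
    refine mul_le_mul_of_nonneg_left ?_ (sq_nonneg _)
    refine (variance_le_expectation_sq (by fun_prop)).trans ?_
    refine le_of_eq_of_le ?_ (h.covMat_diag_le hc j m)
    simp [covMat, sq]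
  have hmean : ∫ ε, (∑ j, fun ε : Fin n → E p => ω j * ε j m) ε ∂(Measure.pi ν) = 0 := by
    simp only [Finset.sum_apply]
    rw [integral_finsetSum _ fun j _ => (hL' j).integrable one_le_two]
    refine Finset.sum_eq_zero fun j _ => ?_
    rw [integral_const_mul]
    have := integral_comp_eval (μ := ν) (i := j) (f := fun e : E p => e m)
      (Measurable.aestronglyMeasurable (by fun_prop))
    rw [this, h.mean_zero, mul_zero]
  have hmem : MemLp (∑ j, fun ε : Fin n → E p => ω j * ε j m) 2 (Measure.pi ν) :=
    memLp_finsetSum' _ fun j _ => hL' j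
  have hch := meas_ge_le_variance_div_sq hmem ht
  rw [hmean] at hch
  simp only [sub_zero, Finset.sum_apply] at hch
  refine hch.trans (ENNReal.ofReal_le_ofReal ?_)
  gcongr

end NoiseAssumption

/-- The entry is a coordinate of the image of a unit vector. Spectral consistency thereby controls
the estimated variances. -/
theorem abs_diag_le_norm_toEuclideanCLM {p : ℕ} (A : Matrix (Fin p) (Fin p) ℝ) (m : Fin p) :
    |A m m| ≤ ‖Matrix.toEuclideanCLM (𝕜 := ℝ) A‖ := by
  have h1 : A m m = (Matrix.toEuclideanCLM (𝕜 := ℝ) A (EuclideanSpace.single m 1)) m := by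
    simp [Matrix.ofLp_toEuclideanCLM]
  rw [h1, ← Real.norm_eq_abs]
  refine (PiLp.norm_apply_le _ m).trans ((ContinuousLinearMap.le_opNorm _ _).trans_eq ?_)
  simp

/-! ### Kernel weights at a fixed bandwidth, and the number of indices. -/

namespace Setup

variable {d p : ℕ} {D : Setup d p}

theorem bw_pos (hdesign : D.DesignAssumption) (hbw : D.BandwidthAssumption) (k : ℕ) :
    0 < D.bw k :=
  mul_pos ((norm_nonneg _).trans_lt (hdesign.bounded 0)) (pow_pos hbw.a_pos k)

theorem tendsto_bw (hbw : D.BandwidthAssumption) : Tendsto D.bw atTop (𝓝 0) := by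
  have := (tendsto_pow_atTop_nhds_zero_of_lt_one hbw.a_pos.le hbw.a_lt_one).const_mul D.hmax
  rw [mul_zero] at this
  exact this

theorem eventually_le_N (hdesign : D.DesignAssumption) (hbw : D.BandwidthAssumption) (k : ℕ) :
    ∀ᶠ n in atTop, k ≤ D.N n := by
  filter_upwards [hbw.hmin_tendsto.eventually (gt_mem_nhds (bw_pos hdesign hbw k))] with n hn
  by_contra! h
  have hmax := (norm_nonneg _).trans_lt (hdesign.bounded 0)
  have : D.bw k ≤ D.hmin n :=
    mul_le_mul_of_nonneg_left (pow_le_pow_of_le_one hbw.a_pos.le hbw.a_lt_one.le h.le) hmax.le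
  linarith

theorem weight_eq (n : ℕ) {h : ℝ} (hh : 0 < h) (i j : Fin n) :
    D.weight n h i j = D.K (h⁻¹ • (D.X i - D.X j)) / ∑ k : Fin n, D.K (h⁻¹ • (D.X i - D.X k)) := by
  have := pow_pos hh d
  simp only [weight, Kh]
  rw [← Finset.sum_div, div_div_div_cancel_right₀ this.ne']

theorem sum_kernel_pos (hK : D.KernelAssumption) (n : ℕ) (h : ℝ) (i : Fin n) :
    0 < ∑ k : Fin n, D.K (h⁻¹ • (D.X i - D.X k)) := by
  obtain ⟨C, hC, -, hlow⟩ := hK.lower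
  refine Finset.sum_pos' (fun k _ => hK.nonneg _) ⟨i, Finset.mem_univ _, ?_⟩
  refine hC.trans_le (hlow _ ?_)
  simp

theorem weight_nonneg (hK : D.KernelAssumption) (n : ℕ) {h : ℝ} (hh : 0 < h) (i j : Fin n) :
    0 ≤ D.weight n h i j := by
  rw [weight_eq n hh]
  exact div_nonneg (hK.nonneg _) (sum_kernel_pos hK n h i).le

theorem sum_weight (hK : D.KernelAssumption) (n : ℕ) {h : ℝ} (hh : 0 < h) (i : Fin n) :
    ∑ j, D.weight n h i j = 1 := by
  simp_rw [weight_eq n hh]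
  rw [← Finset.sum_div, div_self (sum_kernel_pos hK n h i).ne']

theorem weight_eq_zero (hK : D.KernelAssumption) (n : ℕ) {h : ℝ} (hh : 0 < h) {i j : Fin n}
    (hij : h < ‖D.X i - D.X j‖) : D.weight n h i j = 0 := by
  rw [weight_eq n hh, hK.support, zero_div]
  rw [norm_smul, norm_inv, Real.norm_of_nonneg hh.le, ← div_eq_inv_mul, one_lt_div hh]
  exact hij

theorem mul_ballCount_le_sum_kernel (hK : D.KernelAssumption) {C : ℝ}
    (hC : ∀ x, ‖x‖ ≤ 1 / 2 → C ≤ D.K x) (n : ℕ) {h h' : ℝ} (hh : 0 < h) (hh' : h' ≤ h / 2)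
    (i : Fin n) : C * D.ballCount n h' i ≤ ∑ k : Fin n, D.K (h⁻¹ • (D.X i - D.X k)) := by
  classical
  have hcard : D.ballCount n h' i
      = (Finset.univ.filter fun j : Fin n => ‖D.X j - D.X i‖ ≤ h').card := by
    rw [ballCount, Nat.card_eq_fintype_card, Fintype.card_subtype]
  rw [hcard, mul_comm, ← nsmul_eq_mul]
  refine (Finset.card_nsmul_le_sum _ _ C fun j hj => hC _ ?_).trans
    (Finset.sum_le_sum_of_subset_of_nonneg (Finset.filter_subset _ _) fun k _ _ => hK.nonneg _)
  have hj' := (Finset.mem_filter.1 hj).2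
  rw [norm_smul, norm_inv, Real.norm_of_nonneg hh.le, ← div_eq_inv_mul, div_le_iff₀ hh,
    norm_sub_rev]
  linarith

/-- For a fixed bandwidth the squared weights sum up to `O(1 / n)`. -/
theorem exists_sum_sq_weight_le (hdesign : D.DesignAssumption) (hbw : D.BandwidthAssumption)
    (hK : D.KernelAssumption) (k : ℕ) :
    ∃ C : ℝ, 0 < C ∧ ∀ᶠ n : ℕ in atTop, ∀ i : Fin n,
      ∑ j, D.weight n (D.bw k) i j ^ 2 ≤ C / n := by
  obtain ⟨CK, hCK, -, hlow⟩ := hK.lower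
  obtain ⟨C₁, C₂, hC₁, -, hcount⟩ := hdesign.count
  have hh := bw_pos hdesign hbw k
  -- The kernel is bounded below only on the half ball, and points are counted only at bandwidth
  -- values; so a second fixed bandwidth below half the first is used.
  obtain ⟨k', hk'⟩ :=
    ((tendsto_bw hbw).eventually (gt_mem_nhds (half_pos hh))).exists
  have hh' := bw_pos hdesign hbw k'
  refine ⟨(CK * (C₁ * D.bw k' ^ d))⁻¹, by positivity, ?_⟩
  filter_upwards [hcount, eventually_le_N hdesign hbw k', eventually_gt_atTop 0]
    with n hn hkn hn0 i
  have hn0' : (0 : ℝ) < n := Nat.cast_pos.2 hn0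
  have hsum : CK * (C₁ * n * D.bw k' ^ d) ≤ ∑ l : Fin n, D.K ((D.bw k)⁻¹ • (D.X i - D.X l)) :=
    (mul_le_mul_of_nonneg_left (hn i k' hkn).1 hCK.le).trans
      (mul_ballCount_le_sum_kernel hK hlow n hh hk'.le i)
  have hpos : 0 < CK * (C₁ * n * D.bw k' ^ d) := by positivity
  -- Each weight is `O(1/n)` since `K ≤ 1`; as the weights sum to one, the sum of squares is at most
  -- this bound.
  have hle : ∀ j, D.weight n (D.bw k) i j ≤ 1 / (CK * (C₁ * n * D.bw k' ^ d)) := by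
    intro j
    rw [weight_eq n hh]
    exact div_le_div₀ zero_le_one (hK.le_one _) hpos hsum
  calc ∑ j, D.weight n (D.bw k) i j ^ 2
      ≤ ∑ j, 1 / (CK * (C₁ * n * D.bw k' ^ d)) * D.weight n (D.bw k) i j := by
        refine Finset.sum_le_sum fun j _ => ?_
        rw [sq]
        exact mul_le_mul_of_nonneg_right (hle j) (weight_nonneg hK n hh i j)
    _ = 1 / (CK * (C₁ * n * D.bw k' ^ d)) := by
        rw [← Finset.mul_sum, sum_weight hK n hh, mul_one]
    _ = (CK * (C₁ * D.bw k' ^ d))⁻¹ / n := by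
        field_simp

theorem card_S_le (n : ℕ) : ((D.S n).card : ℝ) ≤ n * (p * (D.N n + 1)) := by
  have h : (D.S n).card ≤ n * (p * (D.N n + 1)) := by
    refine (Finset.card_filter_le _ _).trans_eq ?_
    simp
  exact_mod_cast h

/-- The union bound for the simulated statistic at the level `√(6 log n)`. -/
theorem tendsto_card_S_mul_exp (hbw : D.BandwidthAssumption) :
    Tendsto (fun n : ℕ => ((D.S n).card : ℝ) * Real.exp (-(Real.sqrt (6 * Real.log n)) ^ 2 / 2))
      atTop (𝓝 0) := by
  obtain ⟨C, hC, hN⟩ := hbw.card_le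
  have h0 : Tendsto (fun n : ℕ => (p * C : ℝ) / n) atTop (𝓝 0) :=
    tendsto_const_div_atTop_nhds_zero_nat _
  refine squeeze_zero' (Eventually.of_forall fun n => by positivity) ?_ h0
  filter_upwards [hN, eventually_gt_atTop 0] with n hn hn0
  have hn1 : (1 : ℝ) ≤ n := by exact_mod_cast hn0
  have hn0' : (0 : ℝ) < n := by linarith
  have hlog : 0 ≤ Real.log n := Real.log_nonneg hn1
  have hlogle : Real.log n ≤ n := (Real.log_le_sub_one_of_pos hn0').trans (by linarith)
  -- The constant `6` gives `n⁻³`, which beats the `O(n²)` bound on the number of indices.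
  have hexp : Real.exp (-(Real.sqrt (6 * Real.log n)) ^ 2 / 2) = 1 / (n : ℝ) ^ 3 := by
    rw [Real.sq_sqrt (by positivity), show -(6 * Real.log n) / 2 = -(3 * Real.log n) by ring,
      Real.exp_neg, show 3 * Real.log (n : ℝ) = Real.log ((n : ℝ) ^ 3) by
        rw [Real.log_pow]; norm_num, Real.exp_log (by positivity), one_div]
  rw [hexp]
  have hcard : ((D.S n).card : ℝ) ≤ n * (p * (C * n)) := by
    refine (card_S_le n).trans ?_
    gcongr
    exact hn.trans (by gcongr)
  rw [mul_one_div, div_le_div_iff₀ (by positivity) hn0']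
  calc ((D.S n).card : ℝ) * n ≤ n * (p * (C * n)) * n := by gcongr
    _ = p * C * n ^ 3 := by ring

end Setup
end CMITest

/-! ### Rejection at large studentized estimators, and the local alternatives. -/

namespace CMITest
namespace Setup

variable {d p : ℕ} {D : Setup d p}

/-- Both tests reject when some studentized estimator exceeds `B + β_n`, where `B` is so large that
the union bound at `B` is below the level. -/
theorem test_functions_eq_zero (ht : D.TestFunctionAssumption) (hl : D.LevelAssumption) {n : ℕ}
    {y : Fin n → E p} (hpos : ∀ i, (D.sigmaHat n i y).PosSemidef) {B : ℝ} (hB : 0 < B)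
    (hexp : (D.S n).card * Real.exp (-B ^ 2 / 2) ≤ D.α - 2 * D.γ n)
    {s : Fin n × Fin p × ℕ} (hs : s ∈ D.S n)
    (hstud : B + D.β n ≤ D.smooth n y s / D.Vhat n y s) :
    D.gPIA n y = 0 ∧ D.gRMS n y = 0 := by
  have hα := hl.α_pos
  have hα' := hl.α_lt_one
  have hγ := hl.γ_pos n
  have hγ' := hl.γ_lt n
  have hβ := ht.β_pos n
  have hT : B + D.β n ≤ D.That n y :=
    hstud.trans (le_maxOver (fun s => D.smooth n y s / D.Vhat n y s) hs)
  -- The largest level needed is that of the RMS test; arbitrary `A ⊆ D.S n` allows the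
  -- data-dependent selection.
  have hcrit : ∀ (A : Finset (Fin n × Fin p × ℕ)) (q : ℝ), A ⊆ D.S n → 0 < q →
      q ≤ 1 - D.α + 2 * D.γ n → D.crit n A q y ≤ B := by
    intro A q hA hq0 hq
    rw [crit_le_iff ht n A y hq0 (by linarith)]
    have hcard : (A.card : ℝ) * Real.exp (-B ^ 2 / 2) ≤ D.α - 2 * D.γ n := by
      refine le_trans ?_ hexp
      gcongr
    linarith [one_sub_le_simAccept ht n A y hpos hB]
  have hzero : ∀ c, c ≤ B → D.g₀ ((D.That n y - c) / D.β n) = 0 := by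
    intro c hc
    refine ht.eq_zero _ ?_
    rw [le_div_iff₀ hβ]
    linarith
  refine ⟨hzero _ (hcrit _ _ subset_rfl (by linarith) (by linarith)), ?_⟩
  -- Otherwise the conditional expectation at `-β_n` would be at least `1 - γ_n`, which exceeds one
  -- half because `γ_n < α / 2 < 1 / 2`.
  have hpre : -D.β n ≤ D.critPIA n (1 - D.γ n) y := by
    by_contra! h
    have h1 := (crit_le_iff ht n (D.S n) y (q := 1 - D.γ n) (by linarith) (by linarith)
      (-D.β n)).1 h.le
    have h2 := simAccept_le_half ht n ⟨s, hs⟩ y (le_refl (-D.β n))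
    linarith
  have hmem : s ∈ D.SRMS n y := by
    refine Finset.mem_filter.2 ⟨hs, ?_⟩
    linarith
  have hne : (D.SRMS n y).Nonempty := ⟨s, hmem⟩
  simp only [gRMS, hne, if_true]
  exact hzero _ (hcrit _ _ (Finset.filter_subset _ _) (by linarith) le_rfl)

/-- There is a fixed bandwidth with a test point around which the alternative is bounded away
from the null hypothesis. -/
theorem exists_bandwidth_lower_bound (hdesign : D.DesignAssumption) (hbw : D.BandwidthAssumption)
    (hK : D.KernelAssumption) (hpoints : D.TestPointAssumption) {f : E d → E p}
    (hf : ∀ m, Continuous fun x => f x m) (hdist : 0 < distNull D.X f) :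
    ∃ (k : ℕ) (m : Fin p) (ρ : ℝ), 0 < ρ ∧ ∀ᶠ n in atTop, ∃ i : Fin n, (i, m, k) ∈ D.S n ∧
      ∀ j, D.weight n (D.bw k) i j ≠ 0 → ρ ≤ f (D.X j) m := by
  obtain ⟨i₀, hi₀⟩ := lt_iSup_iff.1 hdist
  obtain ⟨m, hm⟩ := lt_iSup_iff.1 hi₀
  have hfpos : 0 < f (D.X i₀) m := ENNReal.ofReal_pos.1 hm
  have hnear : ∀ᶠ x in 𝓝 (D.X i₀), f (D.X i₀) m / 2 < f x m :=
    (hf m).continuousAt.eventually (lt_mem_nhds (half_lt_self hfpos))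
  obtain ⟨r, hr, hball⟩ := Metric.eventually_nhds_iff.1 hnear
  -- The test point lies within `2h` of the positive point and the window adds another `h`; hence
  -- `3h < r`.
  obtain ⟨k, hk⟩ := ((tendsto_bw hbw).eventually
    (gt_mem_nhds (show (0 : ℝ) < r / 3 by positivity))).exists
  refine ⟨k, m, f (D.X i₀) m / 2, half_pos hfpos, ?_⟩
  filter_upwards [eventually_gt_atTop i₀, eventually_le_N hdesign hbw k] with n hn hkn
  obtain ⟨i, hiI, hi⟩ := hpoints.covering n k hkn ⟨i₀, hn⟩
  refine ⟨i, ?_, fun j hj => (hball ?_).le⟩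
  · simp [S, hiI, Nat.lt_succ_of_le hkn]
  · have hij : ‖D.X i - D.X j‖ ≤ D.bw k := by
      by_contra! h
      exact hj (weight_eq_zero hK n (bw_pos hdesign hbw k) h)
    have h3 := norm_sub_le_norm_sub_add_norm_sub (D.X i₀) (D.X i) (D.X j)
    rw [dist_comm, dist_eq_norm]
    linarith

theorem le_smooth_of_forall_weight_ne_zero (hK : D.KernelAssumption) {n : ℕ}
    {s : Fin n × Fin p × ℕ} (hs : 0 < D.bw s.2.2) {y : Fin n → E p} {b : ℝ}
    (h : ∀ j, D.weight n (D.bw s.2.2) s.1 j ≠ 0 → b ≤ y j s.2.1) : b ≤ D.smooth n y s := by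
  calc b = ∑ j, D.weight n (D.bw s.2.2) s.1 j * b := by
        rw [← Finset.sum_mul, sum_weight hK n hs, one_mul]
    _ ≤ D.smooth n y s := by
        refine Finset.sum_le_sum fun j _ => ?_
        by_cases hj : D.weight n (D.bw s.2.2) s.1 j = 0
        · simp [hj]
        · exact mul_le_mul_of_nonneg_left (h j hj) (weight_nonneg hK n hs _ _)

/-- Weights summing to one cannot all vanish. Positivity matters because a quotient by a zero `Vhat`
would be zero. -/
theorem Vhat_pos_of_lower (hK : D.KernelAssumption) {n : ℕ} {s : Fin n × Fin p × ℕ}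
    (hs : 0 < D.bw s.2.2) {y : Fin n → E p} {v : ℝ} (hv : 0 < v)
    (h : ∀ j, v ≤ D.sigmaHat n j y s.2.1 s.2.1) : 0 < D.Vhat n y s := by
  refine Real.sqrt_pos.2 ?_
  have hex : ∃ j, D.weight n (D.bw s.2.2) s.1 j ≠ 0 := by
    by_contra! h0
    have := sum_weight hK n hs s.1
    simp [h0] at this
  obtain ⟨j, hj⟩ := hex
  exact Finset.sum_pos' (fun i _ => mul_nonneg (sq_nonneg _) (hv.le.trans (h i)))
    ⟨j, Finset.mem_univ _, mul_pos (by positivity) (hv.trans_le (h j))⟩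

theorem Vhat_le_of_upper {n : ℕ} {s : Fin n × Fin p × ℕ} {y : Fin n → E p} {M W : ℝ}
    (hM : 0 ≤ M) (hW : ∑ j, D.weight n (D.bw s.2.2) s.1 j ^ 2 ≤ W)
    (h : ∀ j, D.sigmaHat n j y s.2.1 s.2.1 ≤ M) : D.Vhat n y s ≤ Real.sqrt (W * M) := by
  refine Real.sqrt_le_sqrt ?_
  calc ∑ j, D.weight n (D.bw s.2.2) s.1 j ^ 2 * D.sigmaHat n j y s.2.1 s.2.1
      ≤ ∑ j, D.weight n (D.bw s.2.2) s.1 j ^ 2 * M :=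
        Finset.sum_le_sum fun j _ => mul_le_mul_of_nonneg_left (h j) (sq_nonneg _)
    _ ≤ W * M := by
        rw [← Finset.sum_mul]
        exact mul_le_mul_of_nonneg_right hW hM

end Setup

/-- The expectation of a statistic with values at most `1` is at most the probability of an event
outside of which it vanishes. -/
theorem Model.expect_le {d p n : ℕ} (w : Model d p n) (X : ℕ → E d) {g : (Fin n → E p) → ℝ}
    (hg : ∀ y, g y ≤ 1) {U V : Set (Fin n → E p)}
    (h : ∀ ε, ε ∉ U → ε ∉ V → g (w.response X ε) = 0) :
    w.expect X g ≤ w.noiseLaw U + w.noiseLaw V := by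
  refine le_trans ?_ (measure_union_le U V)
  -- This indicator bound needs no measurability of the exceptional events.
  refine le_trans (lintegral_mono fun ε => ?_) (lintegral_indicator_one_le (U ∪ V))
  by_cases hε : ε ∈ U ∪ V
  · rw [Set.indicator_of_mem hε]
    exact ENNReal.ofReal_le_one.2 (hg _)
  · rw [h ε (fun hU => hε (Or.inl hU)) fun hV => hε (Or.inr hV)]
    simp

theorem tendsto_mul_sq_atTop {a : ℕ → ℝ}
    (ha : Tendsto (fun n : ℕ => Real.sqrt (n / Real.log n) * a n) atTop atTop) :
    Tendsto (fun n : ℕ => (n : ℝ) * a n ^ 2) atTop atTop := by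
  have hlog : ∀ᶠ n : ℕ in atTop, 1 ≤ Real.log n :=
    (Real.tendsto_log_atTop.comp tendsto_natCast_atTop_atTop).eventually_ge_atTop 1
  refine tendsto_atTop_mono' _ ?_ ha
  filter_upwards [hlog, ha.eventually_ge_atTop 1] with n hn hn1
  have h1 : Real.sqrt (n / Real.log n) * a n ≤ (Real.sqrt (n / Real.log n) * a n) ^ 2 := by
    nlinarith
  refine h1.trans ?_
  rw [mul_pow, Real.sq_sqrt (by positivity)]
  gcongr
  exact div_le_self (by positivity) hn

theorem eventually_sqrt_log_add_le {a β : ℕ → ℝ} {C b : ℝ} (hC : 0 < C) (hβ : ∀ n, β n ≤ b)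
    (hb : 0 ≤ b)
    (ha : Tendsto (fun n : ℕ => Real.sqrt (n / Real.log n) * a n) atTop atTop) :
    ∀ᶠ n : ℕ in atTop, Real.sqrt (6 * Real.log n) + β n ≤ C * (Real.sqrt n * a n) := by
  have hlog : ∀ᶠ n : ℕ in atTop, 1 ≤ Real.log n :=
    (Real.tendsto_log_atTop.comp tendsto_natCast_atTop_atTop).eventually_ge_atTop 1
  -- The term `√6` pays for `√(6 log n)`, and `b` pays for `β_n`, since `√(log n) ≥ 1`.
  filter_upwards [hlog, ha.eventually_ge_atTop ((Real.sqrt 6 + b) / C)] with n hn hn1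
  have h1 : 1 ≤ Real.sqrt (Real.log n) := Real.one_le_sqrt.2 hn
  rw [Real.sqrt_div (Nat.cast_nonneg n), div_le_iff₀ hC, div_mul_eq_mul_div,
    div_mul_eq_mul_div, le_div_iff₀ (by linarith)] at hn1
  rw [Real.sqrt_mul (by norm_num)]
  nlinarith [hβ n, Real.sqrt_nonneg 6]

namespace Setup

variable {d p : ℕ} {D : Setup d p}

/-- Uniformly over the local alternatives, a statistic with values at most `1` that vanishes
whenever a studentized estimator exceeds `√(6 log n) + β_n` has expectation tending to zero. -/
theorem tendsto_iSup_expect {c : Constants} (hc : c.Admissible)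
    (hdesign : D.DesignAssumption) (hbw : D.BandwidthAssumption)
    (hkernel : D.KernelAssumption) (htest : D.TestFunctionAssumption)
    (hpoints : D.TestPointAssumption)
    {f₀ : E d → E p} (hf₀ : RegressionAssumption c f₀) (hdist : 0 < distNull D.X f₀)
    {a : ℕ → ℝ} (ha_pos : ∀ n, 0 < a n)
    (ha_rate : Tendsto (fun n : ℕ => Real.sqrt (n / Real.log n) * a n) atTop atTop)
    {κ : ℝ} (hκ : 0 < κ)
    (hvar : D.VarianceAssumption κ
      fun n => {w ∈ modelClass p c D.X n | w.f = fun x => a n • f₀ x})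
    {g : (n : ℕ) → (Fin n → E p) → ℝ} (hg : ∀ n y, g n y ≤ 1)
    (hzero : ∀ᶠ n : ℕ in atTop, ∀ y, ∀ s ∈ D.S n,
      Real.sqrt (6 * Real.log n) + D.β n ≤ D.smooth n y s / D.Vhat n y s → g n y = 0) :
    Tendsto (fun n : ℕ => ⨆ w ∈ {w ∈ modelClass p c D.X n | w.f = fun x => a n • f₀ x},
        w.expect D.X (g n)) atTop (𝓝 0) := by
  have hcont : ∀ m, Continuous fun x => f₀ x m := fun m =>
    (hf₀.flatHolder m).isHolder.contDiff.continuous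
  obtain ⟨k, m, ρ, hρ, hpt⟩ :=
    exists_bandwidth_lower_bound hdesign hbw hkernel hpoints hcont hdist
  obtain ⟨W, hW, hweight⟩ := exists_sum_sq_weight_le hdesign hbw hkernel k
  obtain ⟨b, hb, hβ⟩ := htest.β_le
  have hv := hc.varLow_pos
  have hM := hc.momBound_pos
  have hbwk := bw_pos hdesign hbw k
  -- The first bound keeps the estimated variances above `c.varLow / 2`, the second keeps them below
  -- `2 + c.momBound`.
  set η : ℝ := min (c.varLow / 2) 1 with hη
  have hηpos : 0 < η := lt_min (by positivity) one_pos
  have hηv : η ≤ c.varLow / 2 := min_le_left _ _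
  have hη1 : η ≤ 1 := min_le_right _ _
  have hbad := hvar.consistent η hηpos
  have hcheb : Tendsto (fun n : ℕ => ENNReal.ofReal
      (W / n * (1 + c.momBound) / (a n * ρ / 2) ^ 2)) atTop (𝓝 0) := by
    have h1 : Tendsto (fun n : ℕ => (4 * W * (1 + c.momBound) / ρ ^ 2) / (n * a n ^ 2))
        atTop (𝓝 0) := (tendsto_mul_sq_atTop ha_rate).const_div_atTop _
    have h2 := ENNReal.tendsto_ofReal h1
    rw [ENNReal.ofReal_zero] at h2
    refine h2.congr' ?_
    filter_upwards [eventually_gt_atTop 0] with n hn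
    have hn' : (n : ℝ) ≠ 0 := by positivity
    have := (ha_pos n).ne'
    congr 1
    field_simp
    norm_num
  -- Half the signal remains after the noise; the denominator is the bound on the estimated
  -- deviation, scaled by `√n`.
  have hC : 0 < ρ / 2 / Real.sqrt (W * (2 + c.momBound)) := by positivity
  have hlim := hbad.add hcheb
  rw [add_zero] at hlim
  refine tendsto_of_tendsto_of_tendsto_of_le_of_le' tendsto_const_nhds hlim
    (Eventually.of_forall fun n => zero_le) ?_
  filter_upwards [hpt, hweight, hzero, eventually_gt_atTop 0,
    eventually_sqrt_log_add_le hC hβ hb.le ha_rate] with n hpt hweight hzero hn hlarge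
  -- The test point may vary with `n`, but is chosen before the model `w`, as are all constants;
  -- this gives uniformity.
  obtain ⟨i, hiS, hi⟩ := hpt
  have hn1 : (1 : ℝ) ≤ n := by exact_mod_cast hn
  have hn0 : (0 : ℝ) < n := by linarith
  have han := ha_pos n
  refine iSup₂_le fun w hw => ?_
  have hnoise : NoiseAssumption c D.X w.ν := hw.1.2
  have hwf : w.f = fun x => a n • f₀ x := hw.2
  have hle := w.expect_le D.X (hg n)
    (U := {ε | ∃ i : Fin n, η * (n : ℝ) ^ (-κ) < ‖Matrix.toEuclideanCLM (𝕜 := ℝ)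
        (D.sigmaHat n i (w.response D.X ε) - covMat (w.ν i))‖})
    (V := {ε | a n * ρ / 2 ≤ |∑ j, D.weight n (D.bw k) i j * ε j m|}) ?_
  · refine hle.trans (add_le_add ?_ ?_)
    · exact le_iSup₂ (f := fun (w : Model d p n)
        (_ : w ∈ {w ∈ modelClass p c D.X n | w.f = fun x => a n • f₀ x}) => w.noiseLaw
        {ε | ∃ i : Fin n, η * (n : ℝ) ^ (-κ) < ‖Matrix.toEuclideanCLM (𝕜 := ℝ)
        (D.sigmaHat n i (w.response D.X ε) - covMat (w.ν i))‖}) w hw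
    · refine (hnoise.measure_weighted_sum_ge_le hc _ m (by positivity)).trans
        (ENNReal.ofReal_le_ofReal ?_)
      gcongr
      exact hweight i
  · intro ε hU hV
    set y := w.response D.X ε with hy
    have hdev : ∀ j, |D.sigmaHat n j y m m - covMat (w.ν j) m m| ≤ η := by
      intro j
      have h1 : ‖Matrix.toEuclideanCLM (𝕜 := ℝ) (D.sigmaHat n j y - covMat (w.ν j))‖
          ≤ η * (n : ℝ) ^ (-κ) := by
        by_contra! h
        exact hU ⟨j, h⟩
      have h2 : (n : ℝ) ^ (-κ) ≤ 1 := Real.rpow_le_one_of_one_le_of_nonpos hn1 (by linarith)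
      have h3 := abs_diag_le_norm_toEuclideanCLM (D.sigmaHat n j y - covMat (w.ν j)) m
      rw [Matrix.sub_apply] at h3
      nlinarith
    have hnoise_small : |∑ j, D.weight n (D.bw k) i j * ε j m| < a n * ρ / 2 := not_le.1 hV
    have hVpos : 0 < D.Vhat n y (i, m, k) :=
      Vhat_pos_of_lower hkernel hbwk (v := c.varLow / 2) (by positivity) fun j => by
        have := (abs_le.1 (hdev j)).1
        have := hnoise.var_low j m
        dsimp only
        linarith
    have hVle : D.Vhat n y (i, m, k) ≤ Real.sqrt (W / n * (2 + c.momBound)) :=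
      Vhat_le_of_upper (by linarith) (hweight i) fun j => by
        have := (abs_le.1 (hdev j)).2
        have := hnoise.covMat_diag_le hc j m
        dsimp only
        linarith
    have hsignal : a n * ρ ≤ D.smooth n (fun j => w.f (D.X j)) (i, m, k) :=
      le_smooth_of_forall_weight_ne_zero hkernel hbwk fun j hj => by
        simp only [hwf]
        exact mul_le_mul_of_nonneg_left (hi j hj) han.le
    have hsplit : D.smooth n y (i, m, k) = D.smooth n (fun j => w.f (D.X j)) (i, m, k)
        + ∑ j, D.weight n (D.bw k) i j * ε j m :=
      D.smooth_add n (fun j => w.f (D.X j)) ε (i, m, k)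
    have hnum : a n * ρ / 2 ≤ D.smooth n y (i, m, k) := by
      rw [hsplit]
      linarith [(abs_lt.1 hnoise_small).1]
    refine hzero y (i, m, k) hiS (hlarge.trans ?_)
    calc ρ / 2 / Real.sqrt (W * (2 + c.momBound)) * (Real.sqrt n * a n)
        = a n * ρ / 2 / Real.sqrt (W / n * (2 + c.momBound)) := by
          rw [div_mul_eq_mul_div W, Real.sqrt_div (by positivity)]
          have : Real.sqrt n ≠ 0 := by positivity
          have : Real.sqrt (W * (2 + c.momBound)) ≠ 0 := by positivity
          field_simp
      _ ≤ D.smooth n y (i, m, k) / D.Vhat n y (i, m, k) :=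
        div_le_div₀ (le_trans (by positivity) hnum) hnum hVpos hVle

theorem gPIA_le_one (ht : D.TestFunctionAssumption) (n : ℕ) (y : Fin n → E p) :
    D.gPIA n y ≤ 1 := (ht.mem_Icc _).2

theorem gRMS_le_one (ht : D.TestFunctionAssumption) (n : ℕ) (y : Fin n → E p) :
    D.gRMS n y ≤ 1 := by
  unfold gRMS
  split_ifs
  · exact (ht.mem_Icc _).2
  · exact le_rfl

theorem eventually_test_functions_eq_zero (hbw : D.BandwidthAssumption)
    (ht : D.TestFunctionAssumption) (hl : D.LevelAssumption)
    (hpos : ∀ n i y, (D.sigmaHat n i y).PosSemidef) :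
    ∀ᶠ n : ℕ in atTop, ∀ y, ∀ s ∈ D.S n,
      Real.sqrt (6 * Real.log n) + D.β n ≤ D.smooth n y s / D.Vhat n y s →
        D.gPIA n y = 0 ∧ D.gRMS n y = 0 := by
  obtain ⟨b, hb, hγ⟩ := hl.γ_le
  -- The gap between `γ_n` and `α / 2` leaves the union bound a fixed margin `α - 2b > 0`.
  filter_upwards [(tendsto_card_S_mul_exp hbw).eventually
    (gt_mem_nhds (show (0 : ℝ) < D.α - 2 * b by linarith)), eventually_gt_atTop 1]
    with n hn hn1 y s hs hstud
  have hlog : 0 < Real.log n := Real.log_pos (by exact_mod_cast hn1)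
  exact test_functions_eq_zero ht hl (fun i => hpos n i y) (by positivity)
    (by linarith [hγ n]) hs hstud

end Setup
end CMITest

theorem theorem3 {d p : ℕ} (D : Setup d p) (c : Constants) (hc : c.Admissible)
    (hdesign : D.DesignAssumption) (hbw : D.BandwidthAssumption)
    (hkernel : D.KernelAssumption) (htest : D.TestFunctionAssumption)
    (hpoints : D.TestPointAssumption) (hlevel : D.LevelAssumption)
    (f₀ : E d → E p) (hf₀ : RegressionAssumption c f₀) (hdist : 0 < distNull D.X f₀)
    (a : ℕ → ℝ) (ha_pos : ∀ n, 0 < a n) (ha_zero : Tendsto a atTop (𝓝 0))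
    (ha_rate : Tendsto (fun n : ℕ => Real.sqrt (n / Real.log n) * a n) atTop atTop)
    (φ : ℝ) (hφ_pos : 0 < φ) (hφ_lt : φ < 1 / (2 + (d : ℝ)))
    (hvar : D.VarianceAssumption (1 / (2 + (d : ℝ)) - φ)
      fun n => {w ∈ modelClass p c D.X n | w.f = fun x => a n • f₀ x}) :
    ((∀ n, Measurable (D.gPIA n)) ∧
      Tendsto (fun n : ℕ => ⨆ w ∈ {w ∈ modelClass p c D.X n | w.f = fun x => a n • f₀ x},
        w.expect D.X (D.gPIA n)) atTop (𝓝 0)) ∧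
    ((∀ n, Measurable (D.gRMS n)) ∧
      Tendsto (fun n : ℕ => ⨆ w ∈ {w ∈ modelClass p c D.X n | w.f = fun x => a n • f₀ x},
        w.expect D.X (D.gRMS n)) atTop (𝓝 0)) := by
  have hκ : 0 < 1 / (2 + (d : ℝ)) - φ := sub_pos.2 hφ_lt
  have hzero := Setup.eventually_test_functions_eq_zero hbw htest hlevel hvar.posSemidef
  refine ⟨⟨Setup.measurable_gPIA htest hlevel hvar.measurable hvar.posSemidef, ?_⟩,
    ⟨Setup.measurable_gRMS htest hlevel hvar.measurable hvar.posSemidef, ?_⟩⟩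
  · exact Setup.tendsto_iSup_expect hc hdesign hbw hkernel htest hpoints hf₀ hdist ha_pos ha_rate
      hκ hvar (Setup.gPIA_le_one htest)
      (hzero.mono fun n h y s hs hstud => (h y s hs hstud).1)
  · exact Setup.tendsto_iSup_expect hc hdesign hbw hkernel htest hpoints hf₀ hdist ha_pos ha_rate
      hκ hvar (Setup.gRMS_le_one htest)
      (hzero.mono fun n h y s hs hstud => (h y s hs hstud).2)
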